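/- Let $A$ be a finite set, $P$ a probability mass function on $A$, $M:A\to(0,\infty)$ an arbitrary positive mass function, and $\rho:A\times A\to[0,\infty)$ a distortion function with $\rho(x,y)=0$ if and only if $x=y$. For $n\ge 1$, $x_1^n,y_1^n\in A^n$ and nonempty $C\subset A^n$ write $$\rho_n(x_1^n,y_1^n)=\frac1n\sum_{i=1}^n\rho(x_i,y_i),\qquad \rho_n(x_1^n,C)=\min_{y_1^n\in C}\rho_n(x_1^n,y_1^n),\qquad M^n(C)=\sum_{y_1^n\in C}\prod_{i=1}^nM(y_i).$$ For $D\ge 0$ and a probability mass function $Q$ on $A$ let $$I(P,Q,D)=\inf_{W}H(W\|P\times Q),$$ the infimum being over all probability mass functions $W$ on $A\times A$ with first marginal $P$, second marginal $Q$ and $E_W[\rho(X,Y)]\le D$ (and $I(P,Q,D)=\infty$ if there is no such $W$), where $H(\mu\|\nu)=\sum_s\mu(s)\log\frac{\mu(s)}{\nu(s)}$ is the relative entropy, with natural logarithms and the usual conventions $0\log\frac{0}{q}=0$ for $q\ge 0$ and $p\log\frac{p}{0}=\infty$ for $p>0$. Let $$R(D)=\inf_Q\left\{I(P,Q,D)+E_Q[\log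 M(Y)]\right\},$$ the infimum being over all probability mass functions $Q$ on $A$. Let $X_1,X_2,\ldots$ be IID with distribution $P$, i.e. the coordinates of $A^{\mathbb N}$ under the product measure $\mathbb P=P^{\mathbb N}$, and write $X_1^n=(X_1,\ldots,X_n)$. Theorem 2. For every $D\ge 0$ and every $\epsilon>0$ there is a sequence of nonempty sets $C_n\subset A^n$, $n\ge 1$, such that (i) $\frac1n\log M^n(C_n)\le R(D)+\epsilon$ for all $n\ge 1$; (ii) with $\mathbb P$-probability one, $\rho_n(X_1^n,C_n)\le D$ for all sufficiently large $n$. -/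

import Mathlib

open Filter MeasureTheory

noncomputable section

namespace MassCoding

/-- The single-letter distortion `ρ_n(x, y) = (1/n) ∑ ρ(x_i, y_i)` between strings of length `n`. -/
def distortion {A : Type*} (ρ : A → A → ℝ) {n : ℕ} (x y : Fin n → A) : ℝ :=
  (1 / (n : ℝ)) * ∑ i, ρ (x i) (y i)

/-- `ρ_n(x, C) = min_{y ∈ C} ρ_n(x, y)`, with value `⊤` when `C` is empty. -/
def distortionToSet {A : Type*} (ρ : A → A → ℝ) {n : ℕ} (x : Fin n → A)
    (C : Finset (Fin n → A)) : EReal :=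
  C.inf fun y => (distortion ρ x y : EReal)

/-- The mass `M^n(C) = ∑_{y ∈ C} ∏ M(y_i)`. -/
def mass {A : Type*} (M : A → ℝ) {n : ℕ} (C : Finset (Fin n → A)) : ℝ :=
  ∑ y ∈ C, ∏ i, M (y i)

open Classical in
/-- The relative entropy `H(μ‖ν) = ∑ μ(s) log (μ(s)/ν(s))` of two probability mass functions on a
finite set, with the usual conventions `0 log (0/q) = 0` and `p log (p/0) = ∞` for `p > 0`. -/
def relEntropy {S : Type*} [Fintype S] (μ ν : S → ℝ) : EReal :=
  if ∀ s, ν s = 0 → μ s = 0 then ((∑ s, μ s * Real.log (μ s / ν s) : ℝ) : EReal) else ⊤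

/-- The set of probability mass functions `W` on `A × A` with first marginal `P`, second
marginal `Q` and `E_W[ρ(X, Y)] ≤ D`. -/
def couplings {A : Type*} [Fintype A] (ρ : A → A → ℝ) (P Q : A → ℝ) (D : ℝ) :
    Set (A × A → ℝ) :=
  {W | W ∈ stdSimplex ℝ (A × A) ∧ (∀ a, ∑ b, W (a, b) = P a) ∧ (∀ b, ∑ a, W (a, b) = Q b) ∧
    ∑ z, W z * ρ z.1 z.2 ≤ D}

/-- `I(P, Q, D)`, the infimum of `H(W‖P × Q)` over the admissible couplings `W`
(the infimum over the empty set is `⊤`). -/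
def rateInf {A : Type*} [Fintype A] (ρ : A → A → ℝ) (P Q : A → ℝ) (D : ℝ) : EReal :=
  ⨅ W ∈ couplings ρ P Q D, relEntropy W (fun z => P z.1 * Q z.2)

/-- The rate function `R(D; P, M) = inf_Q { I(P, Q, D) + E_Q[log M(Y)] }`, the infimum being over
all probability mass functions `Q` on `A`. -/
def rate {A : Type*} [Fintype A] (ρ : A → A → ℝ) (P M : A → ℝ) (D : ℝ) : EReal :=
  ⨅ Q ∈ stdSimplex ℝ A, rateInf ρ P Q D + ((∑ b, Q b * Real.log (M b) : ℝ) : EReal)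

end MassCoding

end

/-!
The code is found by random coding, made deterministic by a greedy choice.

Fix a pair `(Q, W)` that is optimal for the rate function up to a small error. If `0 < D`, mixing
`W` with the joint law of `(X, X)` pushes the expected distortion strictly below `D` at small cost,
because the information of a coupling is a combination of entropies and so is continuous up to the
boundary of the simplex; if `D = 0`, then `ρ` vanishes on the support of `W`, and no margin is
needed (`exists_coupling_margin`).

Call a source string typical if its empirical means of three conditional expectations under `W`,
those of the information density, of `log M` and of `ρ`, are close to the true means. By the strong
law of large numbers the source is almost surely typical from some length on
(`ae_eventually_mem_typicalStrings`), so it is enough to cover all typical strings; no rate of decay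
for the failure probability is required. Given a typical `x`, a string drawn from the conditional
law of `W` has, by Chebyshev's inequality and with probability at least `1 / 2`, controlled
information density, mass and distortion (`half_le_sum_prod_kernel`). A change of measure turns this
into the lower bound `exp (-n (I + 2 δ)) / 2` for the probability that a `Q`-random string of mass
at most `exp (n (E log M + 2 δ))` lies within distortion `D` of `x`
(`exp_le_sum_prod_of_mem_typicalStrings`). Since there are only exponentially many strings, a greedy
choice (`exists_greedy_cover`) of `exp (n (I + 3 δ))` such strings covers every typical `x`
(`eventually_exists_code`). At the remaining lengths the constant string at a letter of least mass
satisfies the bound on the mass, because `R(D)` is at least the minimum of `log M` by Gibbs'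
inequality.
-/

namespace MassCoding

/-! ### Greedy covering -/

open Classical in
/-- Derandomized random coding. If every `x ∈ T` is covered by a `q`-random element of `S` with
probability at least `p`, then `k` suitably chosen elements of `S` leave at most a fraction
`(1 - p) ^ k` of `T` uncovered: the best next element covers at least the average. -/
theorem exists_greedy_cover {X Y : Type*} (T : Finset X) (S : Finset Y) (r : X → Y → Prop)
    (q : Y → ℝ) (hq : ∀ y, 0 ≤ q y) (hq1 : ∑ y ∈ S, q y ≤ 1) {p : ℝ} (hp : 0 < p)
    (h : ∀ x ∈ T, p ≤ ∑ y ∈ S with r x y, q y) (k : ℕ) :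
    ∃ C ⊆ S, C.card ≤ k ∧
      ((T.filter fun x => ¬ ∃ y ∈ C, r x y).card : ℝ) ≤ (1 - p) ^ k * T.card := by
  rcases T.eq_empty_or_nonempty with rfl | ⟨x₀, hx₀⟩
  · exact ⟨∅, by simp, by simp, by simp⟩
  have hp1 : p ≤ 1 := (h x₀ hx₀).trans
    ((Finset.sum_le_sum_of_subset_of_nonneg (Finset.filter_subset _ _)
      fun y _ _ => hq y).trans hq1)
  have hS : S.Nonempty := by
    by_contra hS
    rw [Finset.not_nonempty_iff_eq_empty] at hS
    have := h x₀ hx₀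
    simp [hS] at this
    linarith
  induction k with
  | zero => exact ⟨∅, by simp, by simp, by simp⟩
  | succ k ih =>
    obtain ⟨C, hCS, hCk, hC⟩ := ih
    set U := T.filter fun x => ¬ ∃ y ∈ C, r x y with hU
    obtain ⟨y, hyS, hy⟩ := S.exists_max_image (fun y => (U.filter fun x => r x y).card) hS
    refine ⟨insert y C, Finset.insert_subset hyS hCS,
      (Finset.card_insert_le _ _).trans (by omega), ?_⟩
    have havg : p * U.card ≤ (U.filter fun x => r x y).card := by
      calc p * U.card = ∑ x ∈ U, p := by rw [Finset.sum_const, nsmul_eq_mul, mul_comm]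
        _ ≤ ∑ x ∈ U, ∑ y ∈ S with r x y, q y :=
          Finset.sum_le_sum fun x hx => h x (Finset.mem_filter.1 hx).1
        _ = ∑ y ∈ S, q y * (U.filter fun x => r x y).card := by
          simp_rw [Finset.sum_filter]
          rw [Finset.sum_comm]
          refine Finset.sum_congr rfl fun y _ => ?_
          rw [← Finset.sum_filter, Finset.sum_const, nsmul_eq_mul, mul_comm]
        _ ≤ ∑ y' ∈ S, q y' * (U.filter fun x => r x y).card :=
          Finset.sum_le_sum fun y' hy' =>
            mul_le_mul_of_nonneg_left (by exact_mod_cast hy y' hy') (hq y')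
        _ = (∑ y' ∈ S, q y') * (U.filter fun x => r x y).card := by rw [Finset.sum_mul]
        _ ≤ _ := mul_le_of_le_one_left (by positivity) hq1
    have hsplit : (T.filter fun x => ¬ ∃ z ∈ insert y C, r x z) = U.filter fun x => ¬ r x y := by
      ext x
      simp only [hU, Finset.mem_filter, Finset.exists_mem_insert, not_or]
      tauto
    have hcard := U.card_filter_add_card_filter_not (fun x => r x y)
    have hcard' : ((U.filter fun x => r x y).card : ℝ) + (U.filter fun x => ¬ r x y).card
        = U.card := by exact_mod_cast hcard
    rw [hsplit]
    calc ((U.filter fun x => ¬ r x y).card : ℝ) ≤ (1 - p) * U.card := by linarith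
      _ ≤ (1 - p) * ((1 - p) ^ k * T.card) := mul_le_mul_of_nonneg_left hC (by linarith)
      _ = _ := by ring

/-! ### Chebyshev's inequality for product weights -/

theorem sum_prod_eq_one {A : Type*} [Fintype A] {n : ℕ} {w : Fin n → A → ℝ}
    (hw1 : ∀ i, ∑ b, w i b = 1) : ∑ y : Fin n → A, ∏ i, w i (y i) = 1 := by
  classical
  have := Finset.prod_univ_sum (fun _ : Fin n => (Finset.univ : Finset A)) w
  rw [Fintype.piFinset_univ] at this
  rw [← this]
  simp [hw1]

theorem sum_fin_succ_pi {A : Type*} [Fintype A] {n : ℕ} (F : (Fin (n + 1) → A) → ℝ) :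
    ∑ y, F y = ∑ b, ∑ y : Fin n → A, F (Fin.cons b y) := by
  rw [← (Fin.consEquiv fun _ : Fin (n + 1) => A).sum_comp, Fintype.sum_prod_type]
  rfl

theorem sum_prod_mul_sum_eq_zero {A : Type*} [Fintype A] {n : ℕ} {w g : Fin n → A → ℝ}
    (hw1 : ∀ i, ∑ b, w i b = 1) (hg : ∀ i, ∑ b, w i b * g i b = 0) :
    ∑ y : Fin n → A, (∏ i, w i (y i)) * ∑ i, g i (y i) = 0 := by
  induction n with
  | zero => simp
  | succ n ih =>
    have ih' := ih (w := fun i => w i.succ) (g := fun i => g i.succ)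
      (fun i => hw1 _) (fun i => hg _)
    have h1 := sum_prod_eq_one (w := fun i : Fin n => w i.succ) fun i => hw1 _
    rw [sum_fin_succ_pi]
    simp only [Fin.prod_univ_succ, Fin.sum_univ_succ, Fin.cons_zero, Fin.cons_succ]
    calc _ = ∑ b, (w 0 b * g 0 b * (∑ y : Fin n → A, ∏ i, w i.succ (y i)) +
            w 0 b * ∑ y : Fin n → A, (∏ i, w i.succ (y i)) * ∑ i, g i.succ (y i)) := by
          refine Finset.sum_congr rfl fun b _ => ?_
          rw [Finset.mul_sum, Finset.mul_sum, ← Finset.sum_add_distrib]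
          refine Finset.sum_congr rfl fun y _ => ?_
          ring
      _ = 0 := by rw [h1, ih']; simp [hg]

/-- The variance of a sum of independent centred variables is the sum of the variances. -/
theorem sum_prod_mul_sq_sum_le {A : Type*} [Fintype A] {n : ℕ} {w g : Fin n → A → ℝ} {K : ℝ}
    (hw1 : ∀ i, ∑ b, w i b = 1) (hg : ∀ i, ∑ b, w i b * g i b = 0)
    (hK : ∀ i, ∑ b, w i b * g i b ^ 2 ≤ K) :
    ∑ y : Fin n → A, (∏ i, w i (y i)) * (∑ i, g i (y i)) ^ 2 ≤ n * K := by
  induction n with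
  | zero => simp
  | succ n ih =>
    have ih' := ih (w := fun i => w i.succ) (g := fun i => g i.succ)
      (fun i => hw1 _) (fun i => hg _) (fun i => hK _)
    have h0 := sum_prod_mul_sum_eq_zero (w := fun i : Fin n => w i.succ)
      (g := fun i => g i.succ) (fun i => hw1 _) (fun i => hg _)
    have h1 := sum_prod_eq_one (w := fun i : Fin n => w i.succ) fun i => hw1 _
    rw [sum_fin_succ_pi]
    simp only [Fin.prod_univ_succ, Fin.sum_univ_succ, Fin.cons_zero, Fin.cons_succ]
    calc _ = ∑ b, (w 0 b * g 0 b ^ 2 * (∑ y : Fin n → A, ∏ i, w i.succ (y i)) +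
            2 * (w 0 b * g 0 b) *
              (∑ y : Fin n → A, (∏ i, w i.succ (y i)) * ∑ i, g i.succ (y i)) +
            w 0 b *
              ∑ y : Fin n → A, (∏ i, w i.succ (y i)) * (∑ i, g i.succ (y i)) ^ 2) := by
          refine Finset.sum_congr rfl fun b _ => ?_
          rw [Finset.mul_sum, Finset.mul_sum, Finset.mul_sum, ← Finset.sum_add_distrib,
            ← Finset.sum_add_distrib]
          refine Finset.sum_congr rfl fun y _ => ?_
          ring
      _ = ∑ b, w 0 b * g 0 b ^ 2 + (∑ b, w 0 b) *
            ∑ y : Fin n → A, (∏ i, w i.succ (y i)) * (∑ i, g i.succ (y i)) ^ 2 := by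
          rw [h1, h0, Finset.sum_mul, ← Finset.sum_add_distrib]
          simp
      _ ≤ _ := by
          rw [hw1, one_mul]
          push_cast
          linarith [hK 0]

/-- Chebyshev's inequality for a sum of independent variables bounded by `B`, whose means add up
to at most `n * c`. -/
theorem sum_prod_tail_le {A : Type*} [Fintype A] {n : ℕ} {w f : Fin n → A → ℝ} {B c δ : ℝ}
    (hw : ∀ i b, 0 ≤ w i b) (hw1 : ∀ i, ∑ b, w i b = 1) (hB : ∀ i b, |f i b| ≤ B)
    (hc : ∑ i, ∑ b, w i b * f i b ≤ n * c) (hδ : 0 < δ) (hn : 0 < n) :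
    ∑ y : Fin n → A with ¬ ∑ i, f i (y i) ≤ n * (c + δ), ∏ i, w i (y i) ≤ B ^ 2 / (n * δ ^ 2) := by
  have hn' : (0 : ℝ) < n := by exact_mod_cast hn
  set m : Fin n → ℝ := fun i => ∑ b, w i b * f i b with hm
  have hg : ∀ i, ∑ b, w i b * (f i b - m i) = 0 := fun i => by
    simp_rw [mul_sub, Finset.sum_sub_distrib, ← Finset.sum_mul, hw1 i]
    simp [hm]
  have hK : ∀ i, ∑ b, w i b * (f i b - m i) ^ 2 ≤ B ^ 2 := fun i => by
    have e : ∑ b, w i b * (f i b - m i) ^ 2 = ∑ b, w i b * f i b ^ 2 - m i ^ 2 := by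
      calc _ = ∑ b, (w i b * f i b ^ 2 - 2 * m i * (w i b * f i b) + m i ^ 2 * w i b) :=
            Finset.sum_congr rfl fun b _ => by ring
        _ = ∑ b, w i b * f i b ^ 2 - 2 * m i * m i + m i ^ 2 * 1 := by
            rw [Finset.sum_add_distrib, Finset.sum_sub_distrib, ← Finset.mul_sum,
              ← Finset.mul_sum, hw1]
        _ = _ := by ring
    have : ∑ b, w i b * f i b ^ 2 ≤ ∑ b, w i b * B ^ 2 := Finset.sum_le_sum fun b _ =>
      mul_le_mul_of_nonneg_left (sq_le_sq' (abs_le.1 (hB i b)).1 (abs_le.1 (hB i b)).2) (hw i b)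
    rw [← Finset.sum_mul, hw1, one_mul] at this
    nlinarith [sq_nonneg (m i)]
  have hvar := sum_prod_mul_sq_sum_le (w := w) (g := fun i b => f i b - m i) hw1 hg hK
  have hw' : ∀ y : Fin n → A, 0 ≤ ∏ i, w i (y i) := fun y => Finset.prod_nonneg fun i _ => hw i _
  have key : (∑ y : Fin n → A with ¬ ∑ i, f i (y i) ≤ n * (c + δ), ∏ i, w i (y i)) * (n * δ) ^ 2
      ≤ n * B ^ 2 := by
    rw [Finset.sum_mul]
    refine le_trans (Finset.sum_le_sum fun y hy => ?_)
      ((Finset.sum_le_sum_of_subset_of_nonneg (Finset.filter_subset _ _) fun y _ _ =>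
        mul_nonneg (hw' y) (sq_nonneg _)).trans hvar)
    have hy := (Finset.mem_filter.1 hy).2
    refine mul_le_mul_of_nonneg_left (pow_le_pow_left₀ (by positivity) ?_ 2) (hw' y)
    rw [Finset.sum_sub_distrib]
    push Not at hy
    nlinarith
  rw [le_div_iff₀ (by positivity)]
  refine le_of_mul_le_mul_left ?_ hn'
  calc _ = _ := by ring
    _ ≤ _ := key

/-- Conditional typicality: along a string `x` whose conditional means of the functions `f j` are
at most `c j`, a random string drawn coordinatewise from the kernel `V` keeps every empirical mean
below `c j + δ` with probability at least `1 / 2`, once `n` is large. -/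
theorem half_le_sum_prod_kernel {A : Type*} [Fintype A] {m n : ℕ} {V : A → A → ℝ}
    {f : Fin m → A → A → ℝ} {B δ : ℝ} {c : Fin m → ℝ} (x : Fin n → A)
    (hV : ∀ a b, 0 ≤ V a b) (hV1 : ∀ i, ∑ b, V (x i) b = 1) (hB : ∀ j a b, |f j a b| ≤ B)
    (hc : ∀ j, ∑ i, ∑ b, V (x i) b * f j (x i) b ≤ n * c j) (hδ : 0 < δ) (hn : 0 < n)
    (hn2 : m * (B ^ 2 / (n * δ ^ 2)) ≤ 1 / 2) :
    1 / 2 ≤ ∑ y : Fin n → A with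
      (∀ i, 0 < V (x i) (y i)) ∧ ∀ j, ∑ i, f j (x i) (y i) ≤ n * (c j + δ),
        ∏ i, V (x i) (y i) := by
  classical
  have hV' : ∀ y : Fin n → A, 0 ≤ ∏ i, V (x i) (y i) :=
    fun y => Finset.prod_nonneg fun i _ => hV _ _
  have htot := sum_prod_eq_one (w := fun i => V (x i)) hV1
  have hbad : ∀ j, ∑ y : Fin n → A with ¬ ∑ i, f j (x i) (y i) ≤ n * (c j + δ),
      ∏ i, V (x i) (y i) ≤ B ^ 2 / (n * δ ^ 2) := fun j =>
    sum_prod_tail_le (w := fun i => V (x i)) (f := fun i => f j (x i)) (fun i => hV _) hV1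
      (fun i => hB j _) (hc j) hδ hn
  have hpt : ∀ y : Fin n → A, ∏ i, V (x i) (y i) ≤
      (if (∀ i, 0 < V (x i) (y i)) ∧ ∀ j, ∑ i, f j (x i) (y i) ≤ n * (c j + δ) then
        ∏ i, V (x i) (y i) else 0) +
      ∑ j, if ¬ ∑ i, f j (x i) (y i) ≤ n * (c j + δ) then ∏ i, V (x i) (y i) else 0 := by
    intro y
    have hnn : ∀ j, 0 ≤ if ¬ ∑ i, f j (x i) (y i) ≤ n * (c j + δ) then ∏ i, V (x i) (y i)
        else 0 := fun j => by split_ifs <;> simp [hV' y]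
    by_cases h1 : ∀ i, 0 < V (x i) (y i)
    · by_cases h2 : ∀ j, ∑ i, f j (x i) (y i) ≤ n * (c j + δ)
      · rw [if_pos ⟨h1, h2⟩]
        linarith [Finset.sum_nonneg fun j (_ : j ∈ Finset.univ) => hnn j]
      · rw [if_neg fun h => h2 h.2, zero_add]
        push Not at h2
        obtain ⟨j, hj⟩ := h2
        refine le_trans ?_ (Finset.single_le_sum (fun j _ => hnn j) (Finset.mem_univ j))
        rw [if_pos (not_le.2 hj)]
    · rw [if_neg fun h => h1 h.1, zero_add]
      push Not at h1
      obtain ⟨i, hi⟩ := h1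
      rw [Finset.prod_eq_zero (Finset.mem_univ i) (le_antisymm hi (hV _ _))]
      simp
  have hsum := Finset.sum_le_sum fun y (_ : y ∈ (Finset.univ : Finset (Fin n → A))) => hpt y
  rw [htot, Finset.sum_add_distrib, Finset.sum_comm] at hsum
  simp_rw [← Finset.sum_filter] at hsum
  have := Finset.sum_le_sum fun j (_ : j ∈ Finset.univ) => hbad j
  rw [Finset.sum_const, Finset.card_univ, Fintype.card_fin, nsmul_eq_mul] at this
  linarith

/-! ### Couplings and typical strings -/

/-- The relative entropy `H(W ‖ P × Q)` as a real number; it agrees with `relEntropy` when `W` is a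
coupling of `P` and `Q`. -/
noncomputable def jointInfo {A : Type*} [Fintype A] (P Q : A → ℝ) (W : A × A → ℝ) : ℝ :=
  ∑ z, W z * Real.log (W z / (P z.1 * Q z.2))

/-- The three functions of a pair of letters whose empirical means are controlled: the information
density of `W` relative to `P × Q`, the logarithm of the mass of the reproduction letter, and the
distortion. -/
noncomputable def statistic {A : Type*} (P Q : A → ℝ) (W : A × A → ℝ) (M : A → ℝ)
    (ρ : A → A → ℝ) : Fin 3 → A → A → ℝ :=
  ![fun a b => Real.log (W (a, b) / (P a * Q b)), fun _ b => Real.log (M b), ρ]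

/-- The conditional distribution of the second coordinate under `W` given the first, whose
distribution is `P` (the zero function at letters of probability zero). -/
noncomputable def kernel {A : Type*} (P : A → ℝ) (W : A × A → ℝ) (a b : A) : ℝ :=
  W (a, b) / P a

open Classical in
/-- The strings of letters of positive probability along which the conditional means of the
functions `f j` under `kernel P W` exceed their means under `W` by at most `δ` on average. -/
noncomputable def typicalStrings {A : Type*} [Fintype A] (P : A → ℝ) (W : A × A → ℝ)
    (f : Fin 3 → A → A → ℝ) (δ : ℝ) (n : ℕ) : Finset (Fin n → A) :=
  {x | (∀ i, 0 < P (x i)) ∧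
    ∀ j, ∑ i, ∑ b, kernel P W (x i) b * f j (x i) b ≤ n * (∑ z, W z * f j z.1 z.2 + δ)}

section Couplings

variable {A : Type*} [Fintype A] {ρ : A → A → ℝ} {P Q : A → ℝ} {D : ℝ} {W : A × A → ℝ}

theorem le_fst_of_mem_couplings (hW : W ∈ couplings ρ P Q D) (a b : A) : W (a, b) ≤ P a := by
  rw [← hW.2.1 a]
  exact Finset.single_le_sum (f := fun b => W (a, b)) (fun b _ => hW.1.1 _) (Finset.mem_univ b)

theorem le_snd_of_mem_couplings (hW : W ∈ couplings ρ P Q D) (a b : A) : W (a, b) ≤ Q b := by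
  rw [← hW.2.2.1 b]
  exact Finset.single_le_sum (f := fun a => W (a, b)) (fun a _ => hW.1.1 _) (Finset.mem_univ a)

theorem relEntropy_eq_jointInfo (hW : W ∈ couplings ρ P Q D) :
    relEntropy W (fun z => P z.1 * Q z.2) = (jointInfo P Q W : EReal) := by
  rw [relEntropy, if_pos, jointInfo]
  rintro ⟨a, b⟩ h
  have := hW.1.1 (a, b)
  rcases mul_eq_zero.1 h with h | h
  · linarith [le_fst_of_mem_couplings hW a b]
  · linarith [le_snd_of_mem_couplings hW a b]

/-- Gibbs' inequality for a coupling. -/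
theorem jointInfo_nonneg (hP : P ∈ stdSimplex ℝ A) (hQ : Q ∈ stdSimplex ℝ A)
    (hW : W ∈ couplings ρ P Q D) : 0 ≤ jointInfo P Q W := by
  have h : ∑ z, (W z - P z.1 * Q z.2) ≤ jointInfo P Q W := by
    refine Finset.sum_le_sum ?_
    rintro ⟨a, b⟩ -
    rcases (hW.1.1 (a, b)).eq_or_lt with h0 | h0
    · rw [← h0]
      simp only [zero_mul, zero_sub, neg_nonpos]
      exact mul_nonneg (hP.1 a) (hQ.1 b)
    · have h0 : 0 < W (a, b) := h0
      have hPa := h0.trans_le (le_fst_of_mem_couplings hW a b)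
      have hQb := h0.trans_le (le_snd_of_mem_couplings hW a b)
      have := Real.one_sub_inv_le_log_of_pos (div_pos h0 (mul_pos hPa hQb))
      have := mul_le_mul_of_nonneg_left this h0.le
      refine le_trans (le_of_eq ?_) this
      dsimp only
      field_simp
  have h1 : ∑ z : A × A, P z.1 * Q z.2 = 1 := by
    rw [Fintype.sum_prod_type]
    simp_rw [← Finset.mul_sum, hQ.2, mul_one, hP.2]
  rw [Finset.sum_sub_distrib, hW.1.2, h1, sub_self] at h
  exact h

theorem sum_kernel (hW : W ∈ couplings ρ P Q D) {a : A} (ha : 0 < P a) :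
    ∑ b, kernel P W a b = 1 := by
  simp only [kernel]
  rw [← Finset.sum_div, hW.2.1, div_self ha.ne']

theorem kernel_nonneg (hP : P ∈ stdSimplex ℝ A) (hW : W ∈ couplings ρ P Q D) (a b : A) :
    0 ≤ kernel P W a b :=
  div_nonneg (hW.1.1 _) (hP.1 _)

theorem sum_mul_kernel (hW : W ∈ couplings ρ P Q D) (f : A → A → ℝ) :
    ∑ a, P a * ∑ b, kernel P W a b * f a b = ∑ z, W z * f z.1 z.2 := by
  rw [Fintype.sum_prod_type]
  refine Finset.sum_congr rfl fun a _ => ?_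
  rw [Finset.mul_sum]
  refine Finset.sum_congr rfl fun b _ => ?_
  by_cases h : P a = 0
  · have : W (a, b) = 0 := le_antisymm (h ▸ le_fst_of_mem_couplings hW a b) (hW.1.1 _)
    simp [h, this]
  · rw [kernel]
    field_simp

/-- Change of measure: where the kernel is positive, its density with respect to `Q` is the
exponential of the information density. -/
theorem snd_eq_kernel_mul_exp (hW : W ∈ couplings ρ P Q D) {a b : A}
    (h : 0 < kernel P W a b) :
    Q b = kernel P W a b * Real.exp (-Real.log (W (a, b) / (P a * Q b))) := by
  have hW0 : 0 < W (a, b) := by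
    refine lt_of_le_of_ne (hW.1.1 _) fun h0 => ?_
    rw [kernel, ← h0] at h
    simp at h
  have hPa := hW0.trans_le (le_fst_of_mem_couplings hW a b)
  have hQb := hW0.trans_le (le_snd_of_mem_couplings hW a b)
  rw [Real.exp_neg, Real.exp_log (by positivity), kernel]
  field_simp

open Classical in
/-- For a typical source string `x`, a `Q`-random reproduction string is jointly typical with `x`
with probability at least `exp (-n (I + 2 δ)) / 2`. -/
theorem exp_le_sum_prod_of_mem_typicalStrings (hP : P ∈ stdSimplex ℝ A)
    (hW : W ∈ couplings ρ P Q D) {M : A → ℝ} {ρ' : A → A → ℝ} {B δ : ℝ} {n : ℕ}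
    (hB : ∀ j a b, |statistic P Q W M ρ' j a b| ≤ B) (hδ : 0 < δ) (hn : 0 < n)
    (hn2 : 3 * (B ^ 2 / (n * δ ^ 2)) ≤ 1 / 2)
    {x : Fin n → A} (hx : x ∈ typicalStrings P W (statistic P Q W M ρ') δ n) :
    Real.exp (-(n * (jointInfo P Q W + 2 * δ))) / 2 ≤ ∑ y : Fin n → A with
      (∀ i, 0 < kernel P W (x i) (y i)) ∧ ∀ j, ∑ i, statistic P Q W M ρ' j (x i) (y i) ≤
        n * (∑ z, W z * statistic P Q W M ρ' j z.1 z.2 + δ + δ), ∏ i, Q (y i) := by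
  obtain ⟨hxP, hx⟩ := (Finset.mem_filter.1 hx).2
  have half := half_le_sum_prod_kernel x (kernel_nonneg hP hW) (fun i => sum_kernel hW (hxP i)) hB
    hx hδ hn (by simpa using hn2)
  have hexp := Real.exp_pos (-(n * (jointInfo P Q W + 2 * δ)))
  have h := mul_le_mul_of_nonneg_left half hexp.le
  rw [mul_one_div] at h
  refine h.trans ?_
  rw [Finset.mul_sum]
  refine Finset.sum_le_sum fun y hy => ?_
  obtain ⟨hy0, hy⟩ := (Finset.mem_filter.1 hy).2
  rw [Finset.prod_congr rfl fun i _ => snd_eq_kernel_mul_exp hW (hy0 i),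
    Finset.prod_mul_distrib, ← Real.exp_sum, Finset.sum_neg_distrib, mul_comm]
  refine mul_le_mul_of_nonneg_left (Real.exp_le_exp.2 (neg_le_neg ?_))
    (Finset.prod_nonneg fun i _ => (hy0 i).le)
  refine (hy 0).trans (le_of_eq ?_)
  rw [add_assoc, ← two_mul]
  rfl

/-! ### Codes for typical strings -/

/-- At a letter `a₀` of least mass, `log (M a₀)` bounds every mean of `log M` from below, and is the
exponent of the mass of the constant string at `a₀`. -/
theorem exists_mass_singleton_le (A : Type*) [Fintype A] [Nonempty A] {M : A → ℝ}
    (hM : ∀ a, 0 < M a) : ∃ a₀ : A, (∀ Q ∈ stdSimplex ℝ A,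
      Real.log (M a₀) ≤ ∑ b, Q b * Real.log (M b)) ∧ ∀ n : ℕ, 0 < n →
      (1 / (n : ℝ)) * Real.log (mass M {fun _ : Fin n => a₀}) = Real.log (M a₀) := by
  obtain ⟨a₀, h⟩ := Finite.exists_min M
  refine ⟨a₀, fun Q hQ => ?_, fun n hn => ?_⟩
  · calc Real.log (M a₀) = ∑ b, Q b * Real.log (M a₀) := by rw [← Finset.sum_mul, hQ.2, one_mul]
      _ ≤ _ := Finset.sum_le_sum fun b _ =>
        mul_le_mul_of_nonneg_left (Real.log_le_log (hM a₀) (h b)) (hQ.1 b)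
  · have : (n : ℝ) ≠ 0 := by positivity
    simp [mass, this]

/-- Typical source strings of large length are covered, within distortion `D'`, by a set whose mass
has exponent at most `I + E log M + 5 δ`. The code consists of `exp (n (I + 3 δ))` strings, each of
mass at most `exp (n (E log M + 2 δ))`. The last hypothesis says that typical pairs meet the
distortion constraint, by a margin in the mean or at every letter. -/
theorem eventually_exists_code [Nonempty A] (hP : P ∈ stdSimplex ℝ A) (hQ : Q ∈ stdSimplex ℝ A)
    (hW : W ∈ couplings ρ P Q D) {M : A → ℝ} (hM : ∀ a, 0 < M a) {D' δ : ℝ} (hδ : 0 < δ)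
    (hD' : ∑ z, W z * ρ z.1 z.2 + 2 * δ ≤ D' ∨ ∀ z : A × A, 0 < W z → ρ z.1 z.2 ≤ D') :
    ∀ᶠ n : ℕ in atTop, ∃ C : Finset (Fin n → A), C.Nonempty ∧
      (1 / (n : ℝ)) * Real.log (mass M C) ≤
        jointInfo P Q W + ∑ b, Q b * Real.log (M b) + 5 * δ ∧
      ∀ x ∈ typicalStrings P W (statistic P Q W M ρ) δ n, ∃ y ∈ C, distortion ρ x y ≤ D' := by
  classical
  obtain ⟨B, hB⟩ : ∃ B, ∀ j a b, |statistic P Q W M ρ j a b| ≤ B := by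
    obtain ⟨B, hB⟩ := (Set.finite_range fun t : Fin 3 × A × A =>
      |statistic P Q W M ρ t.1 t.2.1 t.2.2|).bddAbove
    exact ⟨B, fun j a b => hB ⟨(j, a, b), rfl⟩⟩
  set L := Real.log (Fintype.card A) with hL
  have hcardA : (0 : ℝ) < Fintype.card A := by exact_mod_cast Fintype.card_pos
  have hL0 : 0 ≤ L := Real.log_natCast_nonneg _
  have hI := jointInfo_nonneg hP hQ hW
  set I := jointInfo P Q W with hIdef
  set E := ∑ b, Q b * Real.log (M b) with hE
  have hmean : ∑ z, W z * statistic P Q W M ρ 1 z.1 z.2 = E := by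
    rw [Fintype.sum_prod_type, Finset.sum_comm, hE]
    refine Finset.sum_congr rfl fun b _ => ?_
    simp only [statistic, Matrix.cons_val_one, Matrix.cons_val_zero]
    rw [← Finset.sum_mul, hW.2.2.1]
  filter_upwards [eventually_gt_atTop 0,
    tendsto_natCast_atTop_atTop.eventually_ge_atTop (6 * B ^ 2 / δ ^ 2),
    tendsto_natCast_atTop_atTop.eventually_ge_atTop (4 * L / δ ^ 2)] with n hn hn1 hn2
  have hn' : (0 : ℝ) < n := by exact_mod_cast hn
  obtain ⟨a₀, ha₀, ha₀'⟩ := exists_mass_singleton_le A hM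
  set T := typicalStrings P W (statistic P Q W M ρ) δ n with hT
  rcases T.eq_empty_or_nonempty with hT0 | ⟨x₀, hx₀⟩
  · refine ⟨{fun _ => a₀}, Finset.singleton_nonempty _, ?_, by simp [hT0]⟩
    rw [ha₀' n hn]
    linarith [ha₀ Q hQ]
  have hn3 : 3 * (B ^ 2 / (n * δ ^ 2)) ≤ 1 / 2 := by
    rw [div_le_iff₀ (by positivity)] at hn1
    rw [← mul_div_assoc, div_le_iff₀ (by positivity)]
    linarith
  set S : Finset (Fin n → A) := {y | ∏ i, M (y i) ≤ Real.exp (n * (E + 2 * δ))} with hS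
  set p := Real.exp (-(n * (I + 2 * δ))) / 2 with hp
  have hp0 : 0 < p := by positivity
  set r : (Fin n → A) → (Fin n → A) → Prop := fun x y => distortion ρ x y ≤ D' with hr
  have hQn : ∀ y : Fin n → A, 0 ≤ ∏ i, Q (y i) := fun y => Finset.prod_nonneg fun i _ => hQ.1 _
  have hcover : ∀ x ∈ T, p ≤ ∑ y ∈ S with r x y, ∏ i, Q (y i) := by
    intro x hx
    refine (exp_le_sum_prod_of_mem_typicalStrings hP hW hB hδ hn hn3 hx).trans
      (Finset.sum_le_sum_of_subset_of_nonneg (fun y hy => ?_) fun y _ _ => hQn y)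
    obtain ⟨hy0, hy⟩ := (Finset.mem_filter.1 hy).2
    refine Finset.mem_filter.2 ⟨Finset.mem_filter.2 ⟨Finset.mem_univ _, ?_⟩, ?_⟩
    · have := hy 1
      rw [hmean, add_assoc, ← two_mul] at this
      rw [← Real.exp_log (Finset.prod_pos fun i _ => hM (y i)),
        Real.log_prod fun i _ => (hM (y i)).ne']
      exact Real.exp_le_exp.2 this
    · simp only [hr, distortion]
      rw [one_div, inv_mul_le_iff₀ hn']
      rcases hD' with hD' | hD'
      · refine (hy 2).trans (mul_le_mul_of_nonneg_left ?_ hn'.le)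
        rw [add_assoc, ← two_mul]
        exact hD'
      · calc ∑ i, ρ (x i) (y i) ≤ ∑ _i : Fin n, D' := Finset.sum_le_sum fun i _ => by
              refine hD' (x i, y i) (lt_of_le_of_ne (hW.1.1 _) fun h0 => ?_)
              have := hy0 i
              rw [kernel, ← h0] at this
              simp at this
          _ = _ := by simp
  have hq1 : ∑ y ∈ S, ∏ i, Q (y i) ≤ 1 :=
    (Finset.sum_le_sum_of_subset_of_nonneg (Finset.subset_univ _) fun y _ _ => hQn y).trans
      (sum_prod_eq_one (w := fun _ : Fin n => Q) fun _ => hQ.2).le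
  have hp1 : p ≤ 1 := (hcover x₀ hx₀).trans
    ((Finset.sum_le_sum_of_subset_of_nonneg (Finset.filter_subset _ _) fun y _ _ => hQn y).trans
      hq1)
  -- This many strings leave fewer than one element of `T` uncovered, as `|T| ≤ exp (n L)`.
  set k := ⌊n * L / p⌋₊ + 1 with hk
  obtain ⟨C, hCS, hCk, hC⟩ := exists_greedy_cover T S r (fun y => ∏ i, Q (y i)) hQn hq1 hp0
    hcover k
  have hlt : (1 - p) ^ k * (T.card : ℝ) < 1 := by
    have hTcard : (T.card : ℝ) ≤ Real.exp (n * L) := by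
      rw [mul_comm, Real.exp_mul, hL, Real.exp_log hcardA, Real.rpow_natCast]
      have := T.card_le_univ
      rw [Fintype.card_pi_const] at this
      exact_mod_cast this
    have h1 : (1 - p) ^ k ≤ Real.exp (-(p * k)) := by
      rw [← neg_mul, mul_comm, Real.exp_nat_mul]
      exact pow_le_pow_left₀ (by linarith) (by linarith [Real.add_one_le_exp (-p)]) _
    have h2 : n * L < p * k := by
      have := Nat.lt_floor_add_one (n * L / p)
      rw [div_lt_iff₀ hp0] at this
      rw [hk]
      push_cast
      linarith
    calc _ ≤ Real.exp (-(p * k)) * Real.exp (n * L) :=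
          mul_le_mul h1 hTcard (by positivity) (by positivity)
      _ = Real.exp (n * L - p * k) := by rw [← Real.exp_add]; ring_nf
      _ < 1 := by rw [Real.exp_lt_one_iff]; linarith
  have hcov : ∀ x ∈ T, ∃ y ∈ C, r x y := by
    have h0 : (T.filter fun x => ¬ ∃ y ∈ C, r x y).card = 0 := by
      have := hC.trans_lt hlt
      exact_mod_cast Nat.lt_one_iff.1 (by exact_mod_cast this)
    intro x hx
    by_contra hcon
    exact Finset.notMem_empty x (Finset.card_eq_zero.1 h0 ▸ Finset.mem_filter.2 ⟨hx, hcon⟩)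
  obtain ⟨y₀, hy₀, -⟩ := hcov x₀ hx₀
  refine ⟨C, ⟨y₀, hy₀⟩, ?_, hcov⟩
  have hpos : 0 < mass M C :=
    Finset.sum_pos (fun y _ => Finset.prod_pos fun i _ => hM _) ⟨y₀, hy₀⟩
  have hkle : (k : ℝ) ≤ Real.exp (n * δ) * Real.exp (n * (I + 2 * δ)) := by
    have h1 : (k : ℝ) ≤ n * L / p + 1 := by
      rw [hk]
      push_cast
      gcongr
      exact Nat.floor_le (by positivity)
    have h2 : n * L / p = 2 * n * L * Real.exp (n * (I + 2 * δ)) := by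
      rw [hp, Real.exp_neg]
      field_simp
    have h3 : 1 ≤ Real.exp (n * (I + 2 * δ)) := Real.one_le_exp (by positivity)
    have h4 : 2 * n * L + 1 ≤ Real.exp (n * δ) := by
      refine le_trans ?_ (Real.quadratic_le_exp_of_nonneg (by positivity))
      rw [div_le_iff₀ (by positivity)] at hn2
      have := mul_le_mul_of_nonneg_left hn2 hn'.le
      have : 0 < n * δ := by positivity
      nlinarith
    nlinarith
  have hmass : mass M C ≤ Real.exp (n * (I + E + 5 * δ)) := by
    calc mass M C ≤ ∑ _y ∈ C, Real.exp (n * (E + 2 * δ)) :=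
          Finset.sum_le_sum fun y hy => (Finset.mem_filter.1 (hCS hy)).2
      _ = C.card * Real.exp (n * (E + 2 * δ)) := by rw [Finset.sum_const, nsmul_eq_mul]
      _ ≤ (Real.exp (n * δ) * Real.exp (n * (I + 2 * δ))) * Real.exp (n * (E + 2 * δ)) :=
          mul_le_mul_of_nonneg_right (le_trans (by exact_mod_cast hCk) hkle) (by positivity)
      _ = _ := by rw [← Real.exp_add, ← Real.exp_add]; ring_nf
  rw [one_div, inv_mul_le_iff₀ hn']
  exact (Real.log_le_iff_le_exp hpos).2 hmass

end Couplings

/-! ### Nearly optimal couplings -/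

/-- For couplings the information is a combination of the entropies of `W`, `P` and `Q`, and
hence continuous in `W` and `Q` up to the boundary of the simplex. -/
theorem jointInfo_eq_negMulLog {A : Type*} [Fintype A] {ρ : A → A → ℝ} {P Q : A → ℝ} {D : ℝ}
    {W : A × A → ℝ} (hW : W ∈ couplings ρ P Q D) :
    jointInfo P Q W = ∑ a, Real.negMulLog (P a) + ∑ b, Real.negMulLog (Q b) -
      ∑ z, Real.negMulLog (W z) := by
  have h : ∀ z : A × A, W z * Real.log (W z / (P z.1 * Q z.2)) =
      -(W z * Real.log (P z.1)) - W z * Real.log (Q z.2) - Real.negMulLog (W z) := by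
    rintro ⟨a, b⟩
    rcases (hW.1.1 (a, b)).eq_or_lt with h0 | h0
    · rw [← h0]
      simp
    · have h0 : 0 < W (a, b) := h0
      have hPa := h0.trans_le (le_fst_of_mem_couplings hW a b)
      have hQb := h0.trans_le (le_snd_of_mem_couplings hW a b)
      rw [Real.log_div h0.ne' (by positivity), Real.log_mul hPa.ne' hQb.ne', Real.negMulLog]
      ring
  have h1 : ∑ z : A × A, W z * Real.log (P z.1) = -∑ a, Real.negMulLog (P a) := by
    rw [Fintype.sum_prod_type, ← Finset.sum_neg_distrib]
    refine Finset.sum_congr rfl fun a _ => ?_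
    dsimp only
    rw [← Finset.sum_mul, hW.2.1, Real.negMulLog]
    ring
  have h2 : ∑ z : A × A, W z * Real.log (Q z.2) = -∑ b, Real.negMulLog (Q b) := by
    rw [Fintype.sum_prod_type, Finset.sum_comm, ← Finset.sum_neg_distrib]
    refine Finset.sum_congr rfl fun b _ => ?_
    dsimp only
    rw [← Finset.sum_mul, hW.2.2.1, Real.negMulLog]
    ring
  rw [jointInfo, Finset.sum_congr rfl fun z _ => h z, Finset.sum_sub_distrib,
    Finset.sum_sub_distrib, Finset.sum_neg_distrib, h1, h2]
  ring

open Classical in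
/-- The joint distribution of `(X, X)` when `X` has distribution `P`. -/
noncomputable def diagCoupling {A : Type*} (P : A → ℝ) (z : A × A) : ℝ :=
  if z.1 = z.2 then P z.1 else 0

theorem sum_diagCoupling_mul {A : Type*} [Fintype A] (P : A → ℝ) (f : A → A → ℝ) :
    ∑ z, diagCoupling P z * f z.1 z.2 = ∑ a, P a * f a a := by
  classical
  rw [Fintype.sum_prod_type]
  refine Finset.sum_congr rfl fun a _ => ?_
  simp [diagCoupling]

theorem diagCoupling_mem_couplings {A : Type*} [Fintype A] {ρ : A → A → ℝ}
    (hρ : ∀ a, ρ a a = 0) {P : A → ℝ} (hP : P ∈ stdSimplex ℝ A) {D : ℝ} (hD : 0 ≤ D) :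
    diagCoupling P ∈ couplings ρ P P D := by
  classical
  have h1 : ∀ a, ∑ b, diagCoupling P (a, b) = P a := fun a => by simp [diagCoupling]
  refine ⟨⟨fun z => ?_, ?_⟩, h1, fun b => by simp [diagCoupling], ?_⟩
  · rw [diagCoupling]
    split_ifs
    exacts [hP.1 _, le_rfl]
  · rw [Fintype.sum_prod_type]
    simp_rw [h1]
    exact hP.2
  · rw [sum_diagCoupling_mul]
    simpa [hρ] using hD

section Rate

variable {A : Type*} [Fintype A] {P M : A → ℝ} {ρ : A → A → ℝ} {D : ℝ}

theorem log_le_rate (hP : P ∈ stdSimplex ℝ A) {a₀ : A}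
    (ha₀ : ∀ Q ∈ stdSimplex ℝ A, Real.log (M a₀) ≤ ∑ b, Q b * Real.log (M b)) :
    (Real.log (M a₀) : EReal) ≤ rate ρ P M D := by
  refine le_iInf₂ fun Q hQ => ?_
  have h0 : (0 : EReal) ≤ rateInf ρ P Q D := le_iInf₂ fun W hW => by
    rw [relEntropy_eq_jointInfo hW]
    exact_mod_cast jointInfo_nonneg hP hQ hW
  calc (Real.log (M a₀) : EReal) ≤ ((∑ b, Q b * Real.log (M b) : ℝ) : EReal) :=
        EReal.coe_le_coe_iff.2 (ha₀ Q hQ)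
    _ = 0 + _ := (zero_add _).symm
    _ ≤ _ := add_le_add_left h0 _

theorem rate_le {Q : A → ℝ} (hQ : Q ∈ stdSimplex ℝ A) {W : A × A → ℝ}
    (hW : W ∈ couplings ρ P Q D) :
    rate ρ P M D ≤ ((jointInfo P Q W + ∑ b, Q b * Real.log (M b) : ℝ) : EReal) := by
  refine (iInf₂_le Q hQ).trans ?_
  rw [EReal.coe_add, ← relEntropy_eq_jointInfo hW]
  exact add_le_add_left (iInf₂_le W hW) _

/-- A nearly optimal pair `(Q, W)` for the rate function. -/
theorem exists_coupling_lt_rate_add [Nonempty A] (hP : P ∈ stdSimplex ℝ A) (hM : ∀ a, 0 < M a)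
    (hρ : ∀ a, ρ a a = 0) (hD : 0 ≤ D) {ε : ℝ} (hε : 0 < ε) :
    ∃ Q ∈ stdSimplex ℝ A, ∃ W ∈ couplings ρ P Q D,
      ((jointInfo P Q W + ∑ b, Q b * Real.log (M b) : ℝ) : EReal) < rate ρ P M D + (ε : EReal) := by
  obtain ⟨a₀, ha₀, -⟩ := exists_mass_singleton_le A hM
  have hbot : rate ρ P M D ≠ ⊥ := ne_bot_of_le_ne_bot (EReal.coe_ne_bot _) (log_le_rate hP ha₀)
  have htop : rate ρ P M D ≠ ⊤ := ne_top_of_le_ne_top (EReal.coe_ne_top _)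
    (rate_le hP (diagCoupling_mem_couplings hρ hP hD))
  have hlt : rate ρ P M D < rate ρ P M D + (ε : EReal) := by
    lift rate ρ P M D to ℝ using ⟨htop, hbot⟩ with R
    exact_mod_cast lt_add_of_pos_right R hε
  conv_lhs at hlt => rw [rate]
  simp only [iInf_lt_iff] at hlt
  obtain ⟨Q, hQ, h⟩ := hlt
  refine ⟨Q, hQ, ?_⟩
  by_contra! hcon
  refine absurd h (not_lt.2 ?_)
  rw [← EReal.sub_le_iff_le_add (Or.inl (EReal.coe_ne_bot _)) (Or.inl (EReal.coe_ne_top _))]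
  refine le_iInf₂ fun W hW => ?_
  rw [EReal.sub_le_iff_le_add (Or.inl (EReal.coe_ne_bot _)) (Or.inl (EReal.coe_ne_top _)),
    relEntropy_eq_jointInfo hW, ← EReal.coe_add]
  exact hcon W hW

/-- A nearly optimal pair `(Q, W)` that leaves a margin in the distortion constraint. If `0 < D`
the margin comes from mixing with the diagonal coupling, at a cost that is small by continuity;
if `D = 0` there is no slack, but then `ρ` vanishes on the support of `W`. -/
theorem exists_coupling_margin [Nonempty A] (hP : P ∈ stdSimplex ℝ A) (hM : ∀ a, 0 < M a)
    (hρ_nonneg : ∀ a b, 0 ≤ ρ a b) (hρ : ∀ a, ρ a a = 0) (hD : 0 ≤ D) {ε : ℝ} (hε : 0 < ε) :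
    ∃ Q ∈ stdSimplex ℝ A, ∃ W ∈ couplings ρ P Q D,
      ((jointInfo P Q W + ∑ b, Q b * Real.log (M b) : ℝ) : EReal) < rate ρ P M D + (ε : EReal) ∧
      (∑ z, W z * ρ z.1 z.2 < D ∨ ∀ z : A × A, 0 < W z → ρ z.1 z.2 ≤ D) := by
  obtain ⟨Q, hQ, W, hW, hlt⟩ := exists_coupling_lt_rate_add hP hM hρ hD hε
  rcases hD.eq_or_lt with rfl | hD'
  · refine ⟨Q, hQ, W, hW, hlt, Or.inr fun z hz => ?_⟩
    have h := (Finset.single_le_sum (f := fun z => W z * ρ z.1 z.2)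
      (fun z _ => mul_nonneg (hW.1.1 z) (hρ_nonneg _ _)) (Finset.mem_univ z)).trans hW.2.2.2
    exact nonpos_of_mul_nonpos_right h hz
  set Δ := diagCoupling P with hΔdef
  have hΔ : Δ ∈ couplings ρ P P 0 := diagCoupling_mem_couplings hρ hP le_rfl
  set Wt : ℝ → A × A → ℝ := fun t z => (1 - t) * W z + t * Δ z with hWt
  set Qt : ℝ → A → ℝ := fun t b => (1 - t) * Q b + t * P b with hQt
  have hQtmem : ∀ t, 0 ≤ t → t ≤ 1 → Qt t ∈ stdSimplex ℝ A := fun t h0 h1 =>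
    convex_stdSimplex ℝ A hQ hP (sub_nonneg.2 h1) h0 (by ring)
  have hdist : ∀ t, 0 ≤ t → t ≤ 1 → ∑ z, Wt t z * ρ z.1 z.2 ≤ (1 - t) * D := by
    intro t h0 h1
    have e : ∑ z, Wt t z * ρ z.1 z.2 =
        (1 - t) * ∑ z, W z * ρ z.1 z.2 + t * ∑ z, Δ z * ρ z.1 z.2 := by
      rw [Finset.mul_sum, Finset.mul_sum, ← Finset.sum_add_distrib]
      exact Finset.sum_congr rfl fun z _ => by simp only [hWt]; ring
    rw [e]
    nlinarith [mul_le_mul_of_nonneg_left hW.2.2.2 (sub_nonneg.2 h1),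
      mul_nonpos_of_nonneg_of_nonpos h0 hΔ.2.2.2]
  have hWtmem : ∀ t, 0 ≤ t → t ≤ 1 → Wt t ∈ couplings ρ P (Qt t) D := fun t h0 h1 =>
    ⟨convex_stdSimplex ℝ _ hW.1 hΔ.1 (sub_nonneg.2 h1) h0 (by ring),
      fun a => by
        simp only [hWt]
        rw [Finset.sum_add_distrib, ← Finset.mul_sum, ← Finset.mul_sum, hW.2.1, hΔ.2.1]
        ring,
      fun b => by
        simp only [hWt, hQt]
        rw [Finset.sum_add_distrib, ← Finset.mul_sum, ← Finset.mul_sum, hW.2.2.1, hΔ.2.2.1],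
      (hdist t h0 h1).trans (by nlinarith)⟩
  set cost : ℝ → ℝ := fun t => ∑ a, Real.negMulLog (P a) + ∑ b, Real.negMulLog (Qt t b) -
    ∑ z, Real.negMulLog (Wt t z) + ∑ b, Qt t b * Real.log (M b) with hcost
  have hcont : Continuous cost := by
    have h1 : ∀ b, Continuous fun t => Qt t b := fun b => by simp only [hQt]; fun_prop
    have h2 : ∀ z, Continuous fun t => Wt t z := fun z => by simp only [hWt]; fun_prop
    have h3 := fun b => Real.continuous_negMulLog.comp (h1 b)
    have h4 := fun z => Real.continuous_negMulLog.comp (h2 z)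
    simp only [Function.comp_def] at h3 h4
    fun_prop
  have hcost_eq : ∀ t, 0 ≤ t → t ≤ 1 →
      jointInfo P (Qt t) (Wt t) + ∑ b, Qt t b * Real.log (M b) = cost t := fun t h0 h1 => by
    rw [jointInfo_eq_negMulLog (hWtmem t h0 h1)]
  have hQ0 : Qt 0 = Q := by ext; simp [hQt]
  have hW0 : Wt 0 = W := by ext; simp [hWt]
  have hlt0 : (cost 0 : EReal) < rate ρ P M D + (ε : EReal) := by
    rw [← hcost_eq 0 le_rfl zero_le_one, hQ0, hW0]
    exact hlt
  have hev : ∀ᶠ t in nhdsWithin (0 : ℝ) (Set.Ioi 0),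
      (cost t : EReal) < rate ρ P M D + (ε : EReal) :=
    nhdsWithin_le_nhds ((continuous_coe_real_ereal.comp hcont).continuousAt.eventually_lt
      continuousAt_const hlt0)
  obtain ⟨t, ht, ht0, ht1⟩ := (hev.and (Ioo_mem_nhdsGT zero_lt_one)).exists
  refine ⟨Qt t, hQtmem t ht0.le ht1.le, Wt t, hWtmem t ht0.le ht1.le, ?_, Or.inl ?_⟩
  · rw [hcost_eq t ht0.le ht1.le]
    exact ht
  · exact (hdist t ht0.le ht1.le).trans_lt (by nlinarith)

end Rate

/-! ### Typicality of the source -/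

/-- By the strong law of large numbers, a source sequence is almost surely typical from some
length on. -/
theorem ae_eventually_mem_typicalStrings {A : Type*} [Fintype A] [MeasurableSpace A]
    [MeasurableSingletonClass A] (P : PMF A) {ρ : A → A → ℝ} {Q : A → ℝ} {D : ℝ} {W : A × A → ℝ}
    (hW : W ∈ couplings ρ (fun a => (P a).toReal) Q D) (f : Fin 3 → A → A → ℝ) {δ : ℝ}
    (hδ : 0 < δ) :
    ∀ᵐ x : ℕ → A ∂(Measure.infinitePi fun _ : ℕ => P.toMeasure), ∀ᶠ n : ℕ in atTop,
      (fun i : Fin n => x i) ∈ typicalStrings (fun a => (P a).toReal) W f δ n := by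
  set μ := Measure.infinitePi fun _ : ℕ => P.toMeasure with hμ
  have hpos : ∀ᵐ x ∂μ, ∀ i, 0 < (P (x i)).toReal := by
    rw [ae_all_iff]
    intro i
    have h : ∀ᵐ a ∂P.toMeasure, 0 < (P a).toReal := by
      rw [ae_iff, PMF.toMeasure_apply_eq_zero_iff _ (MeasurableSet.of_discrete),
        Set.disjoint_left]
      intro a ha ha'
      exact ha' (ENNReal.toReal_pos ((PMF.mem_support_iff _ _).1 ha) (P.apply_ne_top a))
    exact (measurePreserving_eval_infinitePi (fun _ : ℕ => P.toMeasure) i).quasiMeasurePreserving.ae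
      h
  have hlln : ∀ᵐ x ∂μ, ∀ j, Tendsto (fun n : ℕ => (∑ i ∈ Finset.range n,
      ∑ b, kernel (fun a => (P a).toReal) W (x i) b * f j (x i) b) / n) atTop
      (nhds (∑ z, W z * f j z.1 z.2)) := by
    rw [ae_all_iff]
    intro j
    set F : A → ℝ := fun a => ∑ b, kernel (fun a => (P a).toReal) W a b * f j a b with hF
    have hFm : Measurable F := Measurable.of_discrete
    have hmp := fun i : ℕ => measurePreserving_eval_infinitePi (fun _ : ℕ => P.toMeasure) i
    have hint : Integrable F P.toMeasure := Integrable.of_finite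
    have hindep : ProbabilityTheory.iIndepFun (fun (i : ℕ) (x : ℕ → A) => F (x i)) μ :=
      ProbabilityTheory.iIndepFun_infinitePi (X := fun _ : ℕ => F) fun _ => hFm
    have := ProbabilityTheory.strong_law_ae_real (μ := μ) (fun (i : ℕ) (x : ℕ → A) => F (x i))
      ((hmp 0).integrable_comp_of_integrable hint)
      (fun i k hik => hindep.indepFun hik)
      (fun i => (ProbabilityTheory.IdentDistrib.comp (u := F)
        ⟨(hmp i).aemeasurable, (hmp 0).aemeasurable, by rw [(hmp i).map_eq, (hmp 0).map_eq]⟩ hFm))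
    have hE : ∫ x, F (x 0) ∂μ = ∑ z, W z * f j z.1 z.2 := by
      rw [← sum_mul_kernel hW, ← integral_map (hmp 0).aemeasurable
        hFm.aestronglyMeasurable, (hmp 0).map_eq, PMF.integral_eq_sum]
      rfl
    rw [hE] at this
    exact this
  filter_upwards [hpos, hlln] with x hx0 hx
  have hev : ∀ᶠ n : ℕ in atTop, ∀ j, (∑ i ∈ Finset.range n,
      ∑ b, kernel (fun a => (P a).toReal) W (x i) b * f j (x i) b) / n <
      ∑ z, W z * f j z.1 z.2 + δ :=
    eventually_all.2 fun j => (hx j).eventually_lt_const (lt_add_of_pos_right _ hδ)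
  filter_upwards [hev, eventually_gt_atTop 0] with n hn hn0
  refine Finset.mem_filter.2 ⟨Finset.mem_univ _, fun i => hx0 i, fun j => ?_⟩
  have := hn j
  rw [div_lt_iff₀ (by exact_mod_cast hn0), mul_comm, ← Fin.sum_univ_eq_sum_range
    (fun i => ∑ b, kernel (fun a => (P a).toReal) W (x i) b * f j (x i) b)] at this
  exact this.le

end MassCoding

/-! ### The coding theorem -/

open MassCoding in
theorem theorem2 {A : Type*} [Fintype A] [MeasurableSpace A] [MeasurableSingletonClass A]
    (P : PMF A) (M : A → ℝ) (hM : ∀ a, 0 < M a)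
    (ρ : A → A → ℝ) (hρ_nonneg : ∀ x y, 0 ≤ ρ x y) (hρ : ∀ x y, ρ x y = 0 ↔ x = y)
    (D : ℝ) (hD : 0 ≤ D) (ε : ℝ) (hε : 0 < ε) :
    ∃ C : (n : ℕ) → Finset (Fin n → A),
      (∀ n, 1 ≤ n → (C n).Nonempty ∧
        (((1 / (n : ℝ)) * Real.log (MassCoding.mass M (C n)) : ℝ) : EReal) ≤
          MassCoding.rate ρ (fun a => (P a).toReal) M D + (ε : EReal)) ∧
      ∀ᵐ x : ℕ → A ∂(Measure.infinitePi fun _ : ℕ => P.toMeasure), ∀ᶠ n : ℕ in atTop,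
        MassCoding.distortionToSet ρ (fun i : Fin n => x i) (C n) ≤ (D : EReal) := by
  classical
  obtain ⟨b₀, -⟩ := P.support_nonempty
  have : Nonempty A := ⟨b₀⟩
  have hP : (fun a => (P a).toReal) ∈ stdSimplex ℝ A := by
    refine ⟨fun a => ENNReal.toReal_nonneg, ?_⟩
    have h := P.tsum_coe
    rw [tsum_fintype] at h
    rw [← ENNReal.toReal_sum fun a _ => P.apply_ne_top a, h, ENNReal.toReal_one]
  set p : A → ℝ := fun a => (P a).toReal with hp
  obtain ⟨a₀, ha₀, ha₀'⟩ := exists_mass_singleton_le A hM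
  obtain ⟨Q, hQ, W, hW, hlt, hmargin⟩ := exists_coupling_margin hP hM hρ_nonneg
    (fun a => (hρ a a).2 rfl) hD (half_pos hε)
  obtain ⟨δ, hδ, hδε, hmargin'⟩ : ∃ δ : ℝ, 0 < δ ∧ 5 * δ ≤ ε / 2 ∧
      (∑ z, W z * ρ z.1 z.2 + 2 * δ ≤ D ∨ ∀ z : A × A, 0 < W z → ρ z.1 z.2 ≤ D) := by
    rcases hmargin with h | h
    · refine ⟨min (ε / 10) ((D - ∑ z, W z * ρ z.1 z.2) / 2),
        lt_min (by linarith) (by linarith), ?_, Or.inl ?_⟩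
      · linarith [min_le_left (ε / 10) ((D - ∑ z, W z * ρ z.1 z.2) / 2)]
      · linarith [min_le_right (ε / 10) ((D - ∑ z, W z * ρ z.1 z.2) / 2)]
    · exact ⟨ε / 10, by linarith, by linarith, Or.inr h⟩
  have hcode := eventually_exists_code hP hQ hW hM hδ hmargin'
  set good : (n : ℕ) → Finset (Fin n → A) → Prop := fun n C => C.Nonempty ∧
      (1 / (n : ℝ)) * Real.log (mass M C) ≤
        jointInfo p Q W + ∑ b, Q b * Real.log (M b) + 5 * δ ∧
      ∀ x ∈ typicalStrings p W (statistic p Q W M ρ) δ n, ∃ y ∈ C, distortion ρ x y ≤ D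
  refine ⟨fun n => if h : ∃ C, good n C then h.choose else {fun _ => a₀}, fun n hn => ?_, ?_⟩
  · dsimp only
    split_ifs with h
    · refine ⟨h.choose_spec.1, (EReal.coe_le_coe_iff.2 h.choose_spec.2.1).trans ?_⟩
      have e : (ε : EReal) = ((ε / 2 : ℝ) : EReal) + ((ε / 2 : ℝ) : EReal) := by
        rw [← EReal.coe_add, add_halves]
      rw [e, ← add_assoc, EReal.coe_add]
      exact add_le_add hlt.le (EReal.coe_le_coe_iff.2 hδε)
    · refine ⟨Finset.singleton_nonempty _, ?_⟩
      rw [ha₀' n hn]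
      exact (log_le_rate hP ha₀).trans (le_add_of_nonneg_right (by exact_mod_cast hε.le))
  · filter_upwards [ae_eventually_mem_typicalStrings P hW (statistic p Q W M ρ) hδ] with x hx
    filter_upwards [hx, hcode] with n hxn hn
    have hn : ∃ C, good n C := hn
    rw [dif_pos hn]
    obtain ⟨y, hy, hxy⟩ := hn.choose_spec.2.2 _ hxn
    exact (Finset.inf_le hy).trans (EReal.coe_le_coe_iff.2 hxy)
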